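/- Let $\mathcal M$ be an $n$-dimensional smooth (Hausdorff) manifold. A (smooth) distribution $D$ assigns to each point $x$ a subspace $D_x\subset T_x\mathcal M$, and a (smooth) codistribution $P$ assigns to each point a subspace $P_x\subset T_x^*\mathcal M$, such that every element of $D_x$ (of $P_x$) is the value at $x$ of a smooth vector field (1-form) lying in $D$ (in $P$) at every point; we write $v\in D$, $\omega\in P$ for smooth vector fields and 1-forms lying in $D$, $P$ at every point. A codistribution $P$ is called invariant with respect to $D$ if $L_v\omega\in P$ for all $v\in D$ and $\omega\in P$. The Cauchy-characteristic distribution $\mathcal C(P)$ is the set of all vector fields $v$ such that $v\rfloor\omega=0$ and $v\rfloor\mathrm d\omega\in P$ for all $\omega\in P$. Let $P$ be a codistribution and $D$ an involutive distribution on $\mathcal M$, both of locally constant dimension, with $D\rfloor P=0$, i.e. $v\rfloor\omega=0$ for all $v\in D$, $\omega\in P$. Then the following holds. 1. There exists a unique smallest (with respect to inclusion) codistribution $\hat P$ which contains $P$ and is invariant with respect to $D$. 2. The codistribution $\hat P$ satisfies $D\rfloor\hat P=0$. 3. The distribution $D$ is contained in the Cauchy-characteristic distribution of $\hat P$, i.e.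 $D\subset\mathcal C(\hat P)$. 4. Suppose that the dimension of $\hat P$ is locally constant. Then $\hat P$ is also the smallest among the codistributions of locally constant dimension which contain $P$ and are invariant with respect to $D$. Moreover, in every smooth coordinate chart $\bar x=\Phi(x)$ on an open set $U\subset\mathcal M$ such that $D=\mathrm{span}\{\partial_{\bar x^1},\ldots,\partial_{\bar x^d}\}$ on $U$, the codistribution $\hat P$ locally possesses a basis which is independent of $\bar x^1,\ldots,\bar x^d$: every point of $U$ has an open neighborhood $V\subset U$ on which there are smooth 1-forms $\omega^1,\ldots,\omega^p$ that form a basis of $\hat P_x$ for each $x\in V$ and whose coefficients $\omega^j_i=\partial_{\bar x^i}\rfloor\omega^j$ on $V$ depend only on $\bar x^{d+1},\ldots,\bar x^n$. -/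

import Mathlib

open scoped Manifold ContDiff Topology

noncomputable section

namespace Codist

/-- The model space `ℝⁿ`. -/
abbrev Model (n : ℕ) : Type := EuclideanSpace ℝ (Fin n)

section Fields

variable (n : ℕ) (M : Type*) [TopologicalSpace M] [ChartedSpace (Model n) M]
  [IsManifold (𝓡 n) ∞ M]

/-- Smooth vector fields on `M`: smooth sections of the tangent bundle. -/
abbrev VField : Type _ :=
  ContMDiffSection (𝓡 n) (Model n) ∞ (fun x : M => TangentSpace (𝓡 n) x)

/-- Smooth 1-forms on `M`: smooth sections of the cotangent bundle. -/
abbrev OneForm : Type _ :=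
  ContMDiffSection (𝓡 n) (Model n →L[ℝ] ℝ) ∞
    (fun x : M => TangentSpace (𝓡 n) x →L[ℝ] Bundle.Trivial M ℝ x)

/-- A smooth distribution: a field of subspaces of the tangent spaces, each of which consists of
the values of smooth vector fields that lie in the field of subspaces. No condition on the
dimension is imposed here. -/
@[ext]
structure Distribution where
  fiber : ∀ x : M, Submodule ℝ (TangentSpace (𝓡 n) x)
  smooth' : ∀ x, ∀ u ∈ fiber x, ∃ v : VField n M, (∀ y, v y ∈ fiber y) ∧ v x = u

/-- A smooth codistribution: a field of subspaces of the cotangent spaces, each of which consists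
of the values of smooth 1-forms that lie in the field of subspaces. No condition on the
dimension is imposed here. -/
@[ext]
structure Codistribution where
  fiber : ∀ x : M, Submodule ℝ (TangentSpace (𝓡 n) x →L[ℝ] Bundle.Trivial M ℝ x)
  smooth' : ∀ x, ∀ a ∈ fiber x, ∃ w : OneForm n M, (∀ y, w y ∈ fiber y) ∧ w x = a

end Fields

section Ops

variable {n : ℕ} {M : Type*} [TopologicalSpace M] [ChartedSpace (Model n) M]

/-- The coordinate representation `y ↦ (v¹(y), …, vⁿ(y))` of a vector field in the chart `φ`. -/
def coordField (φ : OpenPartialHomeomorph M (Model n)) (v : ∀ x : M, TangentSpace (𝓡 n) x)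
    (y : Model n) : Model n :=
  mfderiv (𝓡 n) 𝓘(ℝ, Model n) φ (φ.symm y) (v (φ.symm y))

/-- The coordinate representation `y ↦ (ω₁(y), …, ωₙ(y))` of a 1-form in the chart `φ`, as a
function with values in the dual of `ℝⁿ`. -/
def coordForm (φ : OpenPartialHomeomorph M (Model n))
    (w : ∀ x : M, TangentSpace (𝓡 n) x →L[ℝ] ℝ) (y : Model n) : Model n →L[ℝ] ℝ :=
  (w (φ.symm y)).comp (mfderiv 𝓘(ℝ, Model n) (𝓡 n) φ.symm y)

/-- The Lie derivative `L_v ω` of a 1-form, computed at each point `x` in the preferred chart at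
`x` by the formula `L_v ω = (vᵏ ∂ₖ ωᵢ) dxⁱ + ωᵢ dvⁱ`. -/
def lieDeriv (v : ∀ x : M, TangentSpace (𝓡 n) x)
    (w : ∀ x : M, TangentSpace (𝓡 n) x →L[ℝ] ℝ) (x : M) : TangentSpace (𝓡 n) x →L[ℝ] ℝ :=
  let φ := chartAt (Model n) x
  (fderiv ℝ (coordForm φ w) (φ x) (coordField φ v (φ x)) +
    (coordForm φ w (φ x)).comp (fderiv ℝ (coordField φ v) (φ x))).comp
      (mfderiv (𝓡 n) 𝓘(ℝ, Model n) φ x)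

/-- The contraction `u ⌋ dω` of a tangent vector `u` at `x` with the exterior derivative of a
1-form, that is, the covector `u' ↦ dω (u, u')`, computed in the preferred chart at `x` by the
formula `dω (u, u') = ∂_u (ω (u')) - ∂_{u'} (ω (u))` for `u`, `u'` extended with constant
coordinates. -/
def contractExtDeriv (w : ∀ x : M, TangentSpace (𝓡 n) x →L[ℝ] ℝ) (x : M)
    (u : TangentSpace (𝓡 n) x) : TangentSpace (𝓡 n) x →L[ℝ] ℝ :=
  let φ := chartAt (Model n) x
  let A : Model n →L[ℝ] Model n →L[ℝ] ℝ := fderiv ℝ (coordForm φ w) (φ x)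
  ((A - A.flip) (mfderiv (𝓡 n) 𝓘(ℝ, Model n) φ x u)).comp (mfderiv (𝓡 n) 𝓘(ℝ, Model n) φ x)

/-- The coordinate vector field `∂/∂xⁱ` of the chart `φ` at the point `x`; it is used only for `x`
in the domain of `φ`. -/
def coordVec (φ : OpenPartialHomeomorph M (Model n)) (i : Fin n) (x : M) :
    TangentSpace (𝓡 n) x :=
  mfderiv 𝓘(ℝ, Model n) (𝓡 n) φ.symm (φ x) (EuclideanSpace.single i (1 : ℝ))

end Ops

section Notions

variable {n : ℕ} {M : Type*} [TopologicalSpace M] [ChartedSpace (Model n) M]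
  [IsManifold (𝓡 n) ∞ M]

/-- The vector fields that belong to the distribution `D`. -/
def Distribution.sections (D : Distribution n M) : Set (VField n M) :=
  {v | ∀ x, v x ∈ D.fiber x}

/-- The 1-forms that belong to the codistribution `P`. -/
def Codistribution.sections (P : Codistribution n M) : Set (OneForm n M) :=
  {w | ∀ x, w x ∈ P.fiber x}

/-- The dimension of `D` is locally constant. -/
def Distribution.LocConstDim (D : Distribution n M) : Prop :=
  IsLocallyConstant fun x => Module.finrank ℝ (D.fiber x)

/-- The dimension of `P` is locally constant. -/
def Codistribution.LocConstDim (P : Codistribution n M) : Prop :=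
  IsLocallyConstant fun x => Module.finrank ℝ (P.fiber x)

instance : PartialOrder (Codistribution n M) :=
  PartialOrder.lift Codistribution.fiber fun _ _ h => Codistribution.ext h

/-- `P ≤ Q` is inclusion, for the fibres and equivalently for the 1-forms. -/
theorem Codistribution.le_iff_sections {P Q : Codistribution n M} :
    P ≤ Q ↔ P.sections ⊆ Q.sections := by
  constructor
  · intro h w hw x
    exact h x (hw x)
  · intro h x a ha
    obtain ⟨w, hw, rfl⟩ := P.smooth' x a ha
    exact h hw x

/-- `D` is involutive: it is closed under the Lie bracket. -/
def Distribution.Involutive (D : Distribution n M) : Prop :=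
  ∀ v ∈ D.sections, ∀ v' ∈ D.sections, ∀ x,
    VectorField.mlieBracket (𝓡 n) (fun y => v y) (fun y => v' y) x ∈ D.fiber x

/-- `D ⌋ P = 0`. -/
def Contracts (D : Distribution n M) (P : Codistribution n M) : Prop :=
  ∀ v ∈ D.sections, ∀ w ∈ P.sections, ∀ x, w x (v x) = (0 : ℝ)

/-- `P` is invariant with respect to `D`: `L_v ω ∈ P` for all `v ∈ D` and `ω ∈ P`. -/
def Codistribution.Invariant (P : Codistribution n M) (D : Distribution n M) : Prop :=
  ∀ v ∈ D.sections, ∀ w ∈ P.sections, ∀ x,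
    lieDeriv (fun y => v y) (fun y => w y) x ∈ P.fiber x

/-- The Cauchy-characteristic distribution `C(P)`, as the set of all Cauchy-characteristic vector
fields `v` of `P`: those with `v ⌋ P = 0` and `v ⌋ dP ⊆ P`. -/
def Codistribution.cauchyCharacteristic (P : Codistribution n M) : Set (VField n M) :=
  {v | (∀ w ∈ P.sections, ∀ x, w x (v x) = (0 : ℝ)) ∧
    ∀ w ∈ P.sections, ∀ x, contractExtDeriv (fun y => w y) x (v x) ∈ P.fiber x}

/-- The chart `φ` straightens out `D`: on its domain, `D = span {∂/∂x¹, …, ∂/∂xᵈ}`. -/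
def Straightens (φ : OpenPartialHomeomorph M (Model n)) (D : Distribution n M) (d : ℕ) : Prop :=
  ∀ x ∈ φ.source, D.fiber x = Submodule.span ℝ {u | ∃ i : Fin n, i.val < d ∧ u = coordVec φ i x}

/-- On the set `V` in the domain of the chart `φ`, the coefficients `ωᵢ = ω(∂/∂xⁱ)` of the
1-form `ω` do not depend on the first `d` coordinates. -/
def IndepOfFirst (φ : OpenPartialHomeomorph M (Model n)) (d : ℕ) (V : Set M) (w : OneForm n M) :
    Prop :=
  ∀ x ∈ V, ∀ y ∈ V, (∀ k : Fin n, d ≤ k.val → φ x k = φ y k) →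
    ∀ i : Fin n, (w x (coordVec φ i x) : ℝ) = w y (coordVec φ i y)

/-- Around each point of the domain of the chart `φ`, the codistribution `P` has a basis of
1-forms whose coefficients do not depend on the first `d` coordinates. -/
def Codistribution.HasBasisIndepOfFirst (P : Codistribution n M)
    (φ : OpenPartialHomeomorph M (Model n)) (d : ℕ) : Prop :=
  ∀ x₀ ∈ φ.source, ∃ V : Set M, IsOpen V ∧ x₀ ∈ V ∧ V ⊆ φ.source ∧
    ∃ (p : ℕ) (w : Fin p → OneForm n M),
      (∀ x ∈ V, LinearIndependent ℝ (fun j => w j x) ∧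
        Submodule.span ℝ (Set.range fun j => w j x) = P.fiber x) ∧
      ∀ j, IndepOfFirst φ d V (w j)

end Notions

end Codist

end

noncomputable section

namespace Codist

/-! ### Coordinate representations and smoothness -/

section Coordinates

variable {n : ℕ} {M : Type*} [TopologicalSpace M] [ChartedSpace (Model n) M]
  {φ ψ : OpenPartialHomeomorph M (Model n)}

/-! A fibrewise intersection of smooth codistributions need not be smooth, so the hull is built from
smooth 1-forms: those lying in every invariant codistribution that contains `P`. It is invariant
because `L_v ω` is again a smooth form lying in each of them. Smoothness has to be proved, since
`lieDeriv` uses a chart that varies with the point; Cartan's formula `L_v ω = v ⌋ dω + d(ω(v))`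
provides it.

For `u`, `v` in `D` and `ω` annihilating `D`, `(L_v ω)(u) = -ω([v, u])`, which vanishes by
involutivity. Hence the annihilator of `D` competes in the definition of the hull, and the hull
annihilates `D`. Cartan's formula then reduces invariance to `v ⌋ dω ∈ P̂`, the
Cauchy-characteristic property.

In a straightening chart the first `d` coefficients of a form `ω` in `P̂` vanish, so for `k ≤ d` the
derivative of its coefficients along `∂_k` is `∂_k ⌋ dω`, which lies in `P̂`
(`exists_covectorCoord_eq_fderiv`). No differential equation has to be solved: a local frame is
normalized so that a fixed projection `π` sends it to the standard basis
(`exists_normalized_frame`). The derivative of a frame element along `∂_k` is a combination of the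
frame and is killed by `π`, so it is zero (`hasBasisIndepOfFirst`). -/

theorem mdifferentiable_of_mem_maximalAtlas (hφ : φ ∈ IsManifold.maximalAtlas (𝓡 n) ∞ M) :
    φ.MDifferentiable (𝓡 n) (𝓡 n) :=
  ⟨(contMDiffOn_of_mem_maximalAtlas hφ).mdifferentiableOn (by simp),
    (contMDiffOn_symm_of_mem_maximalAtlas hφ).mdifferentiableOn (by simp)⟩

theorem mfderiv_symm_mfderiv (hφ : φ ∈ IsManifold.maximalAtlas (𝓡 n) ∞ M) {x : M}
    (hx : x ∈ φ.source) (u : TangentSpace (𝓡 n) x) :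
    mfderiv 𝓘(ℝ, Model n) (𝓡 n) φ.symm (φ x) (mfderiv (𝓡 n) 𝓘(ℝ, Model n) φ x u) = u :=
  DFunLike.congr_fun ((mdifferentiable_of_mem_maximalAtlas hφ).symm_comp_deriv hx) u

theorem mfderiv_mfderiv_symm (hφ : φ ∈ IsManifold.maximalAtlas (𝓡 n) ∞ M) {x : M}
    (hx : x ∈ φ.source) (u : Model n) :
    mfderiv (𝓡 n) 𝓘(ℝ, Model n) φ x (mfderiv 𝓘(ℝ, Model n) (𝓡 n) φ.symm (φ x) u) = u := by
  have h := DFunLike.congr_fun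
    ((mdifferentiable_of_mem_maximalAtlas hφ).comp_symm_deriv (φ.map_source hx)) u
  -- The base points `φ.symm (φ x)` and `x` are equal only propositionally; generalizing one of them
  -- allows substitution in the dependent types.
  have key : ∀ z, z = x →
      mfderiv (𝓡 n) 𝓘(ℝ, Model n) φ z (mfderiv 𝓘(ℝ, Model n) (𝓡 n) φ.symm (φ x) u) = u →
      mfderiv (𝓡 n) 𝓘(ℝ, Model n) φ x (mfderiv 𝓘(ℝ, Model n) (𝓡 n) φ.symm (φ x) u) = u := by
    rintro z rfl h; exact h
  exact key _ (φ.left_inv hx) h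

/-- Evaluation of a 1-form at a point through its coordinate representation. -/
theorem coordForm_apply_mfderiv (hφ : φ ∈ IsManifold.maximalAtlas (𝓡 n) ∞ M) {x : M}
    (hx : x ∈ φ.source) (w : ∀ x : M, TangentSpace (𝓡 n) x →L[ℝ] ℝ)
    (u : TangentSpace (𝓡 n) x) :
    coordForm φ w (φ x) (mfderiv (𝓡 n) 𝓘(ℝ, Model n) φ x u) = w x u := by
  have h := mfderiv_symm_mfderiv hφ hx u
  have key : ∀ z (_ : z = x) (a : Model n) (a' : TangentSpace (𝓡 n) x),
      (a : TangentSpace (𝓡 n) x) = a' → w z (a : TangentSpace (𝓡 n) z) = w x a' := by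
    rintro z rfl a a' rfl; rfl
  exact key _ (φ.left_inv hx) _ _ h

theorem coordField_apply {x : M} (hx : x ∈ φ.source) (v : ∀ x : M, TangentSpace (𝓡 n) x) :
    coordField φ v (φ x) = mfderiv (𝓡 n) 𝓘(ℝ, Model n) φ x (v x) := by
  have key : ∀ z (_ : z = x),
      (mfderiv (𝓡 n) 𝓘(ℝ, Model n) φ z (v z) : Model n) =
        mfderiv (𝓡 n) 𝓘(ℝ, Model n) φ x (v x) := by
    rintro z rfl; rfl
  exact key _ (φ.left_inv hx)

theorem coordForm_coordField (hφ : φ ∈ IsManifold.maximalAtlas (𝓡 n) ∞ M) {y : Model n}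
    (hy : y ∈ φ.target) (w : ∀ x : M, TangentSpace (𝓡 n) x →L[ℝ] ℝ)
    (v : ∀ x : M, TangentSpace (𝓡 n) x) :
    coordForm φ w y (coordField φ v y) = w (φ.symm y) (v (φ.symm y)) := by
  have h := coordForm_apply_mfderiv hφ (φ.map_target hy) w (v (φ.symm y))
  rw [← coordField_apply (φ.map_target hy), φ.right_inv hy] at h
  exact h

variable [IsManifold (𝓡 n) ∞ M]

theorem contDiffAt_coordField (hφ : φ ∈ IsManifold.maximalAtlas (𝓡 n) ∞ M) (v : VField n M)
    {y : Model n} (hy : y ∈ φ.target) : ContDiffAt ℝ ∞ (coordField φ v) y := by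
  rw [← contMDiffAt_iff_contDiffAt]
  have h1 : ContMDiffOn (𝓡 n).tangent 𝓘(ℝ, Model n).tangent ∞
      (tangentMapWithin (𝓡 n) 𝓘(ℝ, Model n) φ φ.source)
      (Bundle.TotalSpace.proj ⁻¹' φ.source) :=
    (contMDiffOn_of_mem_maximalAtlas hφ).contMDiffOn_tangentMapWithin (by simp)
      φ.open_source.uniqueMDiffOn
  have h2 : ContMDiffOn 𝓘(ℝ, Model n) (𝓡 n).tangent ∞
      (fun y => (⟨φ.symm y, v (φ.symm y)⟩ : TangentBundle (𝓡 n) M)) φ.target :=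
    v.contMDiff.comp_contMDiffOn (contMDiffOn_symm_of_mem_maximalAtlas hφ)
  have h3 := h1.comp h2 (fun y hy => φ.map_target hy)
  have h4 := (contMDiff_snd_tangentBundle_modelSpace (Model n) 𝓘(ℝ, Model n)
    (n := ∞)).comp_contMDiffOn h3
  refine (h4.contMDiffAt (φ.open_target.mem_nhds hy)).congr_of_eventuallyEq ?_
  filter_upwards [φ.open_target.mem_nhds hy] with z hz
  exact DFunLike.congr_fun (mfderivWithin_of_isOpen φ.open_source (φ.map_target hz)).symm _

/-- It suffices to test on a constant vector `u`: the tangent map of the inverse chart carries it to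
a smooth vector field along `φ.symm`, and its pairing with `w` is smooth. -/
theorem contDiffOn_coordForm (hφ : φ ∈ IsManifold.maximalAtlas (𝓡 n) ∞ M) (w : OneForm n M) :
    ContDiffOn ℝ ∞ (coordForm φ w) φ.target := by
  rw [contDiffOn_clm_apply]
  intro u y hy
  refine ContDiffAt.contDiffWithinAt ?_
  have hs : ContMDiffAt 𝓘(ℝ, Model n) (𝓡 n) ∞ φ.symm y :=
    contMDiffAt_symm_of_mem_maximalAtlas hφ hy
  have h1 : ContMDiffOn 𝓘(ℝ, Model n).tangent (𝓡 n).tangent ∞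
      (tangentMapWithin 𝓘(ℝ, Model n) (𝓡 n) φ.symm φ.target)
      (Bundle.TotalSpace.proj ⁻¹' φ.target) :=
    (contMDiffOn_symm_of_mem_maximalAtlas hφ).contMDiffOn_tangentMapWithin (by simp)
      φ.open_target.uniqueMDiffOn
  have h2 : ContMDiff 𝓘(ℝ, Model n) 𝓘(ℝ, Model n).tangent ∞
      (fun y => (⟨y, u⟩ : TangentBundle 𝓘(ℝ, Model n) (Model n))) :=
    contMDiff_vectorSpace_iff_contDiff.2 contDiff_const
  have h3 : ContMDiffAt 𝓘(ℝ, Model n) (𝓡 n).tangent ∞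
      (fun z => (⟨φ.symm z, mfderiv 𝓘(ℝ, Model n) (𝓡 n) φ.symm z u⟩ : TangentBundle (𝓡 n) M)) y := by
    refine ((h1.comp h2.contMDiffOn (s := φ.target) fun z hz => hz).contMDiffAt
      (φ.open_target.mem_nhds hy)).congr_of_eventuallyEq ?_
    filter_upwards [φ.open_target.mem_nhds hy] with z hz
    simp only [Function.comp_def, tangentMapWithin]
    rw [mfderivWithin_of_isOpen φ.open_target hz]
  have h4 := (w.contMDiff (φ.symm y)).comp y hs
  have h5 := ContMDiffAt.clm_bundle_apply (b := φ.symm) (ϕ := fun z => w (φ.symm z)) h4 h3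
  rw [Bundle.contMDiffAt_totalSpace] at h5
  exact contMDiffAt_iff_contDiffAt.1 h5.2

theorem contDiffAt_coordForm (hφ : φ ∈ IsManifold.maximalAtlas (𝓡 n) ∞ M) (w : OneForm n M)
    {y : Model n} (hy : y ∈ φ.target) : ContDiffAt ℝ ∞ (coordForm φ w) y :=
  (contDiffOn_coordForm hφ w).contDiffAt (φ.open_target.mem_nhds hy)

/-- A field of covectors is smooth at a point if its coordinate representation in the preferred
chart at this point is. -/
theorem contMDiffAt_of_contDiffAt_coordForm {w : ∀ x : M, TangentSpace (𝓡 n) x →L[ℝ] ℝ} {x₀ : M}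
    (h : ContDiffAt ℝ ∞ (coordForm (chartAt (Model n) x₀) w) (chartAt (Model n) x₀ x₀)) :
    ContMDiffAt (𝓡 n) ((𝓡 n).prod 𝓘(ℝ, Model n →L[ℝ] ℝ)) ∞
      (fun x => Bundle.TotalSpace.mk' (Model n →L[ℝ] ℝ)
        (E := fun x : M => TangentSpace (𝓡 n) x →L[ℝ] Bundle.Trivial M ℝ x) x (w x)) x₀ := by
  rw [contMDiffAt_hom_bundle]
  refine ⟨contMDiffAt_id, ?_⟩
  have hφ := IsManifold.chart_mem_maximalAtlas (I := 𝓡 n) (n := ∞) x₀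
  have h1 : ContMDiffAt (𝓡 n) 𝓘(ℝ, Model n →L[ℝ] ℝ) ∞
      (coordForm (chartAt (Model n) x₀) w ∘ chartAt (Model n) x₀) x₀ :=
    h.contMDiffAt.comp x₀ (contMDiffAt_of_mem_maximalAtlas hφ (mem_chart_source _ x₀))
  refine h1.congr_of_eventuallyEq ?_
  filter_upwards [(chartAt (Model n) x₀).open_source.mem_nhds (mem_chart_source _ x₀)] with x hx
  ext u
  rw [ContinuousLinearMap.inCoordinates_eq (by simpa using hx) (by simp)]
  have hu := coordForm_apply_mfderiv hφ hx w
    (mfderiv 𝓘(ℝ, Model n) (𝓡 n) (chartAt (Model n) x₀).symm (chartAt (Model n) x₀ x) u)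
  rw [mfderiv_mfderiv_symm hφ hx] at hu
  have hs := DFunLike.congr_fun (TangentBundle.symmL_trivializationAt (I := 𝓡 n) hx) u
  rw [ModelWithCorners.range_eq_univ, mfderivWithin_univ] at hs
  rw [ContinuousLinearMap.comp_apply, ContinuousLinearMap.comp_apply]
  simp only [Bundle.Trivial.continuousLinearEquivAt_trivialization,
    Bundle.Trivial.fiberBundle_trivializationAt']
  refine Eq.trans (congrArg (w x) ?_) hu.symm
  exact (congrFun (Bundle.Trivialization.symm_continuousLinearEquivAt_eq _ hx) u).trans hs

end Coordinates

/-! ### Change of coordinates and tensoriality of the exterior derivative -/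

section Derivatives

variable {n : ℕ} {M : Type*} [TopologicalSpace M] [ChartedSpace (Model n) M]
  {φ ψ : OpenPartialHomeomorph M (Model n)}

theorem fderiv_transition (hφ : φ ∈ IsManifold.maximalAtlas (𝓡 n) ∞ M)
    (hψ : ψ ∈ IsManifold.maximalAtlas (𝓡 n) ∞ M) {y : Model n} (hy : y ∈ φ.target)
    (hy' : φ.symm y ∈ ψ.source) (u : Model n) :
    fderiv ℝ (ψ ∘ φ.symm) y u = mfderiv (𝓡 n) 𝓘(ℝ, Model n) ψ (φ.symm y)
      (mfderiv 𝓘(ℝ, Model n) (𝓡 n) φ.symm y u) := by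
  have h := mfderiv_comp y ((mdifferentiable_of_mem_maximalAtlas hψ).mdifferentiableAt hy')
    ((mdifferentiable_of_mem_maximalAtlas hφ).mdifferentiableAt_symm hy)
  rw [← mfderiv_eq_fderiv]
  exact DFunLike.congr_fun h u

theorem contDiffAt_transition (hφ : φ ∈ IsManifold.maximalAtlas (𝓡 n) ∞ M)
    (hψ : ψ ∈ IsManifold.maximalAtlas (𝓡 n) ∞ M) {y : Model n} (hy : y ∈ φ.target)
    (hy' : φ.symm y ∈ ψ.source) : ContDiffAt ℝ ∞ (ψ ∘ φ.symm) y :=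
  contMDiffAt_iff_contDiffAt.1 <| ContMDiffAt.comp y
    (contMDiffAt_of_mem_maximalAtlas hψ hy') (contMDiffAt_symm_of_mem_maximalAtlas hφ hy)

/-- The transformation law of the coefficients of a 1-form under a change of coordinates. -/
theorem coordForm_transition (hφ : φ ∈ IsManifold.maximalAtlas (𝓡 n) ∞ M)
    (hψ : ψ ∈ IsManifold.maximalAtlas (𝓡 n) ∞ M) (w : ∀ x : M, TangentSpace (𝓡 n) x →L[ℝ] ℝ)
    {y : Model n} (hy : y ∈ φ.target) (hy' : φ.symm y ∈ ψ.source) :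
    coordForm φ w y = (coordForm ψ w ((ψ ∘ φ.symm) y)).comp (fderiv ℝ (ψ ∘ φ.symm) y) := by
  ext u
  rw [ContinuousLinearMap.comp_apply, fderiv_transition hφ hψ hy hy']
  exact (coordForm_apply_mfderiv hψ hy' w _).symm

/-- The antisymmetrized derivative of the coefficients of a 1-form is a tensor. -/
theorem fderiv_coordForm_sub_transition [IsManifold (𝓡 n) ∞ M]
    (hφ : φ ∈ IsManifold.maximalAtlas (𝓡 n) ∞ M)
    (hψ : ψ ∈ IsManifold.maximalAtlas (𝓡 n) ∞ M) (w : OneForm n M)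
    {y : Model n} (hy : y ∈ φ.target) (hy' : φ.symm y ∈ ψ.source) (a b : Model n) :
    fderiv ℝ (coordForm φ w) y a b - fderiv ℝ (coordForm φ w) y b a =
      fderiv ℝ (coordForm ψ w) ((ψ ∘ φ.symm) y) (fderiv ℝ (ψ ∘ φ.symm) y a)
          (fderiv ℝ (ψ ∘ φ.symm) y b) -
        fderiv ℝ (coordForm ψ w) ((ψ ∘ φ.symm) y) (fderiv ℝ (ψ ∘ φ.symm) y b)
          (fderiv ℝ (ψ ∘ φ.symm) y a) := by
  have hτ := contDiffAt_transition hφ hψ hy hy'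
  have hev : coordForm φ w =ᶠ[𝓝 y]
      fun z => (coordForm ψ w ((ψ ∘ φ.symm) z)).comp (fderiv ℝ (ψ ∘ φ.symm) z) := by
    filter_upwards [φ.open_target.mem_nhds hy,
      (φ.continuousAt_symm hy).preimage_mem_nhds (ψ.open_source.mem_nhds hy')] with z hz hz'
    exact coordForm_transition hφ hψ w hz hz'
  have hc : HasFDerivAt (fun z => coordForm ψ w ((ψ ∘ φ.symm) z))
      ((fderiv ℝ (coordForm ψ w) ((ψ ∘ φ.symm) y)).comp (fderiv ℝ (ψ ∘ φ.symm) y)) y :=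
    HasFDerivAt.comp (g := coordForm ψ w) y
      ((contDiffAt_coordForm hψ w (ψ.map_source hy')).differentiableAt (by simp)).hasFDerivAt
      (hτ.differentiableAt (by simp)).hasFDerivAt
  have hd : HasFDerivAt (fderiv ℝ (ψ ∘ φ.symm)) (fderiv ℝ (fderiv ℝ (ψ ∘ φ.symm)) y) y :=
    ((hτ.fderiv_right (m := 1) (by norm_cast)).differentiableAt (by simp)).hasFDerivAt
  -- Differentiating the transformation law produces a term with the second derivative of the
  -- transition map; its symmetry makes this term cancel under antisymmetrization.
  have hsymm : IsSymmSndFDerivAt ℝ (ψ ∘ φ.symm) y :=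
    hτ.isSymmSndFDerivAt (by
      rw [minSmoothness_of_isRCLikeNormedField]
      exact WithTop.coe_le_coe.2 le_top)
  rw [hev.fderiv_eq, (hc.clm_comp hd).fderiv]
  simp [hsymm a b]

end Derivatives

/-! ### Cartan's formula and smoothness of the Lie derivative -/

section Calculus

variable {n : ℕ} {M : Type*} [TopologicalSpace M] [ChartedSpace (Model n) M]
  {φ : OpenPartialHomeomorph M (Model n)}

theorem fderiv_comp_symm_apply_mfderiv (hφ : φ ∈ IsManifold.maximalAtlas (𝓡 n) ∞ M) {x : M}
    (hx : x ∈ φ.source) {f : M → ℝ} (hf : MDifferentiableAt (𝓡 n) 𝓘(ℝ, ℝ) f x)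
    (u : TangentSpace (𝓡 n) x) :
    fderiv ℝ (f ∘ φ.symm) (φ x) (mfderiv (𝓡 n) 𝓘(ℝ, Model n) φ x u) =
      mfderiv (𝓡 n) 𝓘(ℝ, ℝ) f x u := by
  have hsymm : φ.symm (φ x) = x := φ.left_inv hx
  have h := mfderiv_comp_of_eq (x := φ x) (f := φ.symm) (g := f) hf
    ((mdifferentiable_of_mem_maximalAtlas hφ).mdifferentiableAt_symm (φ.map_source hx)) hsymm
  rw [← mfderiv_eq_fderiv, h]
  have key : ∀ z (_ : z = x) (a : Model n) (a' : TangentSpace (𝓡 n) x),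
      (a : TangentSpace (𝓡 n) x) = a' →
      (mfderiv (𝓡 n) 𝓘(ℝ, ℝ) f z (a : TangentSpace (𝓡 n) z) : ℝ) =
        mfderiv (𝓡 n) 𝓘(ℝ, ℝ) f x a' := by
    rintro z rfl a a' rfl; rfl
  exact key _ hsymm _ _ (mfderiv_symm_mfderiv hφ hx u)

variable [IsManifold (𝓡 n) ∞ M]

/-- The exterior derivative may be computed in any chart. -/
theorem contractExtDeriv_apply (hφ : φ ∈ IsManifold.maximalAtlas (𝓡 n) ∞ M) {x : M}
    (hx : x ∈ φ.source) (w : OneForm n M) (u u' : TangentSpace (𝓡 n) x) :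
    contractExtDeriv (fun y => w y) x u u' =
      fderiv ℝ (coordForm φ w) (φ x) (mfderiv (𝓡 n) 𝓘(ℝ, Model n) φ x u)
          (mfderiv (𝓡 n) 𝓘(ℝ, Model n) φ x u') -
        fderiv ℝ (coordForm φ w) (φ x) (mfderiv (𝓡 n) 𝓘(ℝ, Model n) φ x u')
          (mfderiv (𝓡 n) 𝓘(ℝ, Model n) φ x u) := by
  have hψ := IsManifold.chart_mem_maximalAtlas (I := 𝓡 n) (n := ∞) x
  have hxψ := mem_chart_source (Model n) x
  set ψ := chartAt (Model n) x
  have hsymm : φ.symm (φ x) = x := φ.left_inv hx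
  have h := fderiv_coordForm_sub_transition hφ hψ w (φ.map_source hx) (by rwa [hsymm])
    (mfderiv (𝓡 n) 𝓘(ℝ, Model n) φ x u) (mfderiv (𝓡 n) 𝓘(ℝ, Model n) φ x u')
  have hτ : ∀ u : TangentSpace (𝓡 n) x,
      fderiv ℝ (ψ ∘ φ.symm) (φ x) (mfderiv (𝓡 n) 𝓘(ℝ, Model n) φ x u) =
        mfderiv (𝓡 n) 𝓘(ℝ, Model n) ψ x u := by
    intro u
    refine (fderiv_transition hφ hψ (φ.map_source hx) (by rwa [hsymm]) _).trans ?_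
    have key : ∀ z (_ : z = x) (a : Model n) (a' : TangentSpace (𝓡 n) x),
        (a : TangentSpace (𝓡 n) x) = a' →
        (mfderiv (𝓡 n) 𝓘(ℝ, Model n) ψ z (a : TangentSpace (𝓡 n) z) : Model n) =
          mfderiv (𝓡 n) 𝓘(ℝ, Model n) ψ x a' := by
      rintro z rfl a a' rfl; rfl
    exact key _ hsymm _ _ (mfderiv_symm_mfderiv hφ hx u)
  rw [hτ, hτ, Function.comp_apply, hsymm] at h
  exact h.symm

theorem contMDiff_pairing (v : VField n M) (w : OneForm n M) :
    ContMDiff (𝓡 n) 𝓘(ℝ, ℝ) ∞ (fun x => (w x (v x) : ℝ)) := by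
  intro x
  have h := ContMDiffAt.clm_bundle_apply (b := id) (w.contMDiff x) (v.contMDiff x)
  rw [Bundle.contMDiffAt_totalSpace] at h
  exact h.2

theorem contDiffAt_pairing_symm (hφ : φ ∈ IsManifold.maximalAtlas (𝓡 n) ∞ M) (v : VField n M)
    (w : OneForm n M) {y : Model n} (hy : y ∈ φ.target) :
    ContDiffAt ℝ ∞ (fun y => (w (φ.symm y) (v (φ.symm y)) : ℝ)) y :=
  contMDiffAt_iff_contDiffAt.1 <| ContMDiffAt.comp y (contMDiff_pairing v w (φ.symm y))
    (contMDiffAt_symm_of_mem_maximalAtlas hφ hy)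

theorem fderiv_pairing_symm (hφ : φ ∈ IsManifold.maximalAtlas (𝓡 n) ∞ M) (v : VField n M)
    (w : OneForm n M) {y : Model n} (hy : y ∈ φ.target) (a : Model n) :
    fderiv ℝ (fun y => (w (φ.symm y) (v (φ.symm y)) : ℝ)) y a =
      fderiv ℝ (coordForm φ w) y a (coordField φ v y) +
        coordForm φ w y (fderiv ℝ (coordField φ v) y a) := by
  have hev : (fun y => (w (φ.symm y) (v (φ.symm y)) : ℝ)) =ᶠ[𝓝 y]
      fun y => coordForm φ w y (coordField φ v y) := by
    filter_upwards [φ.open_target.mem_nhds hy] with z hz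
    exact (coordForm_coordField hφ hz _ _).symm
  rw [hev.fderiv_eq, fderiv_clm_apply
    ((contDiffAt_coordForm hφ w hy).differentiableAt (by simp))
    ((contDiffAt_coordField hφ v hy).differentiableAt (by simp))]
  simp [add_comm]

/-- Cartan's formula. -/
theorem lieDeriv_apply_eq (hφ : φ ∈ IsManifold.maximalAtlas (𝓡 n) ∞ M) {x : M}
    (hx : x ∈ φ.source) (v : VField n M) (w : OneForm n M) (u : TangentSpace (𝓡 n) x) :
    lieDeriv (fun y => v y) (fun y => w y) x u =
      contractExtDeriv (fun y => w y) x (v x) u +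
        fderiv ℝ (fun y => (w (φ.symm y) (v (φ.symm y)) : ℝ)) (φ x)
          (mfderiv (𝓡 n) 𝓘(ℝ, Model n) φ x u) := by
  have hψ := IsManifold.chart_mem_maximalAtlas (I := 𝓡 n) (n := ∞) x
  have hxψ := mem_chart_source (Model n) x
  have hd := (contMDiff_pairing v w x).mdifferentiableAt (by simp)
  -- The differential of the function `w(v)` is intrinsic, so it can be moved from `φ` to the
  -- preferred chart, where `lieDeriv` is defined.
  have h1 := (fderiv_comp_symm_apply_mfderiv hφ hx hd u).trans
    (fderiv_comp_symm_apply_mfderiv hψ hxψ hd u).symm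
  have h2 := fderiv_pairing_symm hψ v w ((chartAt (Model n) x).map_source hxψ)
    (mfderiv (𝓡 n) 𝓘(ℝ, Model n) (chartAt (Model n) x) x u)
  refine Eq.trans ?_ (congrArg _ (h1.trans h2).symm)
  rw [contractExtDeriv_apply hψ hxψ, ← coordField_apply hxψ (fun y => v y)]
  -- In coordinates `p = (∂_v w)(u)`, `q = (∂_u w)(v)` and `r = w(∂_u v)`.
  have key : ∀ p q r : ℝ, p + r = p - q + (q + r) := by intros; ring
  exact key _ _ _

theorem lieDeriv_eq_contractExtDeriv {v : VField n M} {w : OneForm n M}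
    (h : ∀ x, w x (v x) = (0 : ℝ)) (x : M) :
    lieDeriv (fun y => v y) (fun y => w y) x = contractExtDeriv (fun y => w y) x (v x) := by
  ext u
  rw [lieDeriv_apply_eq (IsManifold.chart_mem_maximalAtlas (I := 𝓡 n) (n := ∞) x)
    (mem_chart_source (Model n) x)]
  simp only [h, fderiv_fun_const]
  exact add_zero _

/-- Both terms of Cartan's formula may be computed in one fixed chart near `x₀`, where they are
smooth expressions in the coefficients. -/
theorem contMDiff_lieDeriv (v : VField n M) (w : OneForm n M) :
    ContMDiff (𝓡 n) ((𝓡 n).prod 𝓘(ℝ, Model n →L[ℝ] ℝ)) ∞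
      (fun x => Bundle.TotalSpace.mk' (Model n →L[ℝ] ℝ)
        (E := fun x : M => TangentSpace (𝓡 n) x →L[ℝ] Bundle.Trivial M ℝ x) x
        (lieDeriv (fun y => v y) (fun y => w y) x)) := by
  intro x₀
  apply contMDiffAt_of_contDiffAt_coordForm
  have hφ := IsManifold.chart_mem_maximalAtlas (I := 𝓡 n) (n := ∞) x₀
  have hx := mem_chart_source (Model n) x₀
  set φ := chartAt (Model n) x₀
  have hy := φ.map_source hx
  have hA : ContDiffAt ℝ ∞ (fderiv ℝ (coordForm φ w)) (φ x₀) :=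
    (contDiffAt_coordForm hφ w hy).fderiv_right (by simp)
  have hf : ContDiffAt ℝ ∞ (fderiv ℝ fun y => (w (φ.symm y) (v (φ.symm y)) : ℝ)) (φ x₀) :=
    (contDiffAt_pairing_symm hφ v w hy).fderiv_right (by simp)
  have hflip : ContDiff ℝ ∞ (fun B : Model n →L[ℝ] Model n →L[ℝ] ℝ => B.flip) := by
    have h := LinearIsometryEquiv.contDiff (𝕜 := ℝ) (n := ∞) (E := Model n →L[ℝ] Model n →L[ℝ] ℝ)
      (F := Model n →L[ℝ] Model n →L[ℝ] ℝ) (ContinuousLinearMap.flipₗᵢ ℝ (Model n) (Model n) ℝ)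
    exact h
  have hAf : ContDiffAt ℝ ∞ (fun y => (fderiv ℝ (coordForm φ w) y).flip) (φ x₀) :=
    hflip.contDiffAt.comp _ hA
  refine (((hA.sub hAf).clm_apply (contDiffAt_coordField hφ v hy)).add hf).congr_of_eventuallyEq ?_
  filter_upwards [φ.open_target.mem_nhds hy] with y hy
  ext u
  have hx' := φ.map_target hy
  have h1 := lieDeriv_apply_eq hφ hx' v w (mfderiv 𝓘(ℝ, Model n) (𝓡 n) φ.symm y u)
  have h2 := mfderiv_mfderiv_symm hφ hx' u
  rw [contractExtDeriv_apply hφ hx', ← coordField_apply hx' (fun y => v y)] at h1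
  rw [φ.right_inv hy] at h1 h2
  rw [h2] at h1
  exact h1

/-- The Lie derivative of a smooth 1-form along a smooth vector field. -/
def lieDerivForm (v : VField n M) (w : OneForm n M) : OneForm n M :=
  ⟨fun x => lieDeriv (fun y => v y) (fun y => w y) x, contMDiff_lieDeriv v w⟩

end Calculus

/-! ### The Lie bracket in coordinates -/

section Bracket

variable {n : ℕ} {M : Type*} [TopologicalSpace M] [ChartedSpace (Model n) M]
  [IsManifold (𝓡 n) ∞ M]

theorem mpullbackWithin_extChartAt_symm (v : VField n M) (x : M) :
    VectorField.mpullbackWithin 𝓘(ℝ, Model n) (𝓡 n) (extChartAt (𝓡 n) x).symm (fun y => v y)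
      (Set.range (𝓡 n)) =ᶠ[𝓝 (extChartAt (𝓡 n) x x)] coordField (chartAt (Model n) x) v := by
  have hφ := IsManifold.chart_mem_maximalAtlas (I := 𝓡 n) (n := ∞) x
  have hx := mem_chart_source (Model n) x
  set φ := chartAt (Model n) x
  filter_upwards [φ.open_target.mem_nhds (φ.map_source hx)] with y hy
  have h1 : (mfderiv 𝓘(ℝ, Model n) (𝓡 n) φ.symm y).inverse =
      mfderiv (𝓡 n) 𝓘(ℝ, Model n) φ (φ.symm y) :=
    ContinuousLinearMap.inverse_eq
      ((mdifferentiable_of_mem_maximalAtlas hφ).symm_comp_deriv (φ.map_target hy) |>.symm ▸ by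
        rw [φ.right_inv hy])
      ((mdifferentiable_of_mem_maximalAtlas hφ).comp_symm_deriv hy)
  rw [VectorField.mpullbackWithin_apply, ModelWithCorners.range_eq_univ, mfderivWithin_univ]
  exact DFunLike.congr_fun h1 _

theorem apply_mlieBracket (v v' : VField n M) (w : OneForm n M) (x : M) :
    w x (VectorField.mlieBracket (𝓡 n) (fun y => v y) (fun y => v' y) x) =
      coordForm (chartAt (Model n) x) w (chartAt (Model n) x x)
        (VectorField.lieBracket ℝ (coordField (chartAt (Model n) x) v)
          (coordField (chartAt (Model n) x) v') (chartAt (Model n) x x)) := by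
  have hφ := IsManifold.chart_mem_maximalAtlas (I := 𝓡 n) (n := ∞) x
  have hx := mem_chart_source (Model n) x
  have hid : mfderiv (𝓡 n) 𝓘(ℝ, Model n) (extChartAt (𝓡 n) x) x =
    ContinuousLinearMap.id ℝ _ := mfderiv_extChartAt_self
  have hb : VectorField.mlieBracket (𝓡 n) (fun y => v y) (fun y => v' y) x =
      VectorField.lieBracket ℝ (coordField (chartAt (Model n) x) v)
          (coordField (chartAt (Model n) x) v') (chartAt (Model n) x x) := by
    rw [← VectorField.mlieBracketWithin_univ, VectorField.mlieBracketWithin_apply, hid,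
      Set.preimage_univ, Set.univ_inter]
    refine (DFunLike.congr_fun
      (ContinuousLinearMap.inverse_id (R := ℝ) (M := Model n)) _).trans ?_
    refine Eq.trans ?_ (Filter.EventuallyEq.lieBracket_vectorField_eq
      (mpullbackWithin_extChartAt_symm v x) (mpullbackWithin_extChartAt_symm v' x))
    rw [ModelWithCorners.range_eq_univ]
    exact congrFun VectorField.lieBracketWithin_univ _
  rw [hb]
  refine (coordForm_apply_mfderiv hφ hx w _).symm.trans (congrArg _ ?_)
  exact DFunLike.congr_fun hid _

/-- The Lie derivative of a 1-form `w` evaluated on a vector field `u` with `w u = 0`. -/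
theorem lieDeriv_apply_of_pairing_eq_zero (v u : VField n M) (w : OneForm n M)
    (h : ∀ x, w x (u x) = (0 : ℝ)) (x : M) :
    lieDeriv (fun y => v y) (fun y => w y) x (u x) =
      - w x (VectorField.mlieBracket (𝓡 n) (fun y => v y) (fun y => u y) x) := by
  have hφ := IsManifold.chart_mem_maximalAtlas (I := 𝓡 n) (n := ∞) x
  have hx := mem_chart_source (Model n) x
  have h1 := fderiv_pairing_symm hφ u w ((chartAt (Model n) x).map_source hx)
    (coordField (chartAt (Model n) x) v (chartAt (Model n) x x))
  simp only [h, fderiv_fun_const] at h1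
  rw [apply_mlieBracket, VectorField.lieBracket, map_sub]
  -- Here `p = (∂_v w)(u)`, `q = w(∂_v u)` and `r = w(∂_u v)`; the relation `p + q = 0` is the
  -- derivative of `w(u) = 0` along `v`.
  have key : ∀ p q r : ℝ, 0 = p + q → p + r = -(q - r) := by intros; linarith
  refine Eq.trans ?_ (key _ _ _ h1)
  rw [coordField_apply hx (fun y => u y)]
  rfl

end Bracket

/-! ### The smallest invariant codistribution and its contraction with `D` -/

section Existence

variable {n : ℕ} {M : Type*} [TopologicalSpace M] [ChartedSpace (Model n) M]
  [IsManifold (𝓡 n) ∞ M]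

/-- The codistribution spanned by the values of a space of 1-forms. -/
def Codistribution.ofSections (S : Submodule ℝ (OneForm n M)) : Codistribution n M where
  fiber x :=
    { carrier := {a | ∃ w ∈ S, w x = a}
      add_mem' := by
        rintro _ _ ⟨w, hw, rfl⟩ ⟨w', hw', rfl⟩
        exact ⟨w + w', S.add_mem hw hw', rfl⟩
      zero_mem' := ⟨0, S.zero_mem, rfl⟩
      smul_mem' := by
        rintro c _ ⟨w, hw, rfl⟩
        exact ⟨c • w, S.smul_mem c hw, rfl⟩ }
  smooth' := by
    rintro x _ ⟨w, hw, rfl⟩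
    exact ⟨w, fun y => ⟨w, hw, rfl⟩, rfl⟩

theorem Codistribution.mem_sections_ofSections {S : Submodule ℝ (OneForm n M)} {w : OneForm n M}
    (hw : w ∈ S) : w ∈ (Codistribution.ofSections S).sections :=
  fun _ => ⟨w, hw, rfl⟩

/-- The smallest codistribution that contains `P` and is invariant with respect to `D`: it is
spanned by the 1-forms that lie in all codistributions of this kind. -/
def invariantHull (P : Codistribution n M) (D : Distribution n M) : Codistribution n M :=
  .ofSections
    { carrier := {w | ∀ Q : Codistribution n M, P ≤ Q → Q.Invariant D → w ∈ Q.sections}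
      add_mem' := fun h h' Q hP hQ x => (Q.fiber x).add_mem (h Q hP hQ x) (h' Q hP hQ x)
      zero_mem' := fun Q _ _ x => (Q.fiber x).zero_mem
      smul_mem' := fun c _ h Q hP hQ x => (Q.fiber x).smul_mem c (h Q hP hQ x) }

theorem invariantHull_le {P Q : Codistribution n M} {D : Distribution n M} (hP : P ≤ Q)
    (hQ : Q.Invariant D) : invariantHull P D ≤ Q := by
  rintro x _ ⟨w, hw, rfl⟩
  exact hw Q hP hQ x

theorem le_invariantHull (P : Codistribution n M) (D : Distribution n M) :
    P ≤ invariantHull P D := by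
  intro x a ha
  obtain ⟨w, hw, rfl⟩ := P.smooth' x a ha
  exact ⟨w, fun Q hP _ y => hP y (hw y), rfl⟩

theorem invariantHull_invariant (P : Codistribution n M) (D : Distribution n M) :
    (invariantHull P D).Invariant D := by
  intro v hv w hw x
  -- The values of `w` may come from different forms at different points, but `w` still lies in
  -- every competitor `Q`, and hence so does its Lie derivative.
  exact ⟨lieDerivForm v w,
    fun Q hP hQ => hQ v hv w fun y => invariantHull_le hP hQ y (hw y), rfl⟩

theorem isLeast_invariantHull (P : Codistribution n M) (D : Distribution n M) :
    IsLeast {Q | P ≤ Q ∧ Q.Invariant D} (invariantHull P D) :=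
  ⟨⟨le_invariantHull P D, invariantHull_invariant P D⟩, fun _ h => invariantHull_le h.1 h.2⟩

/-- The codistribution spanned by the 1-forms that annihilate `D`. -/
def annihilator (D : Distribution n M) : Codistribution n M :=
  .ofSections
    { carrier := {w | ∀ v ∈ D.sections, ∀ x, w x (v x) = (0 : ℝ)}
      add_mem' := fun h h' v hv x => by
        have := congrArg₂ (· + ·) (h v hv x) (h' v hv x)
        exact this.trans (add_zero _)
      zero_mem' := fun _ _ _ => rfl
      smul_mem' := fun c _ h v hv x => (congrArg (c • ·) (h v hv x)).trans (smul_zero c) }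

theorem contracts_annihilator (D : Distribution n M) : Contracts D (annihilator D) := by
  intro v hv w hw x
  obtain ⟨w', hw', h⟩ := hw x
  rw [← h]
  exact hw' v hv x

/-- For `u` in `D` the pairing of `L_v w` with `u` is `-w([v, u])`, and `[v, u]` lies in `D`. The
bracket is replaced by a smooth section of `D` with the same value at the point. -/
theorem annihilator_invariant {D : Distribution n M} (hD : D.Involutive) :
    (annihilator D).Invariant D := by
  intro v hv w hw x
  refine ⟨lieDerivForm v w, fun u hu y => ?_, rfl⟩
  refine (lieDeriv_apply_of_pairing_eq_zero v u w
    (contracts_annihilator D u hu w hw) y).trans ?_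
  obtain ⟨b, hb, hby⟩ := D.smooth' y _ (hD v hv u hu y)
  rw [← hby, contracts_annihilator D b hb w hw, neg_zero]

theorem le_annihilator {P : Codistribution n M} {D : Distribution n M} (h : Contracts D P) :
    P ≤ annihilator D :=
  Codistribution.le_iff_sections.2 fun w hw =>
    Codistribution.mem_sections_ofSections fun v hv x => h v hv w hw x

theorem contracts_invariantHull {P : Codistribution n M} {D : Distribution n M}
    (hD : D.Involutive) (h : Contracts D P) : Contracts D (invariantHull P D) :=
  fun v hv w hw => contracts_annihilator D v hv w
    fun x => invariantHull_le (le_annihilator h) (annihilator_invariant hD) x (hw x)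

theorem sections_subset_cauchyCharacteristic {Q : Codistribution n M} {D : Distribution n M}
    (h : Contracts D Q) (hQ : Q.Invariant D) : D.sections ⊆ Q.cauchyCharacteristic := by
  refine fun v hv => ⟨h v hv, fun w hw x => ?_⟩
  rw [← lieDeriv_eq_contractExtDeriv (h v hv w hw)]
  exact hQ v hv w hw x

end Existence

/-! ### Normalized frames, constancy along coordinates and extension of germs -/

/-- Linearly independent smooth functions `W j` can be combined near a point to functions whose
images under a suitable fixed projection are constant. -/
theorem exists_normalized_frame {E F : Type*} [NormedAddCommGroup E] [NormedSpace ℝ E]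
    [NormedAddCommGroup F] [NormedSpace ℝ F] [FiniteDimensional ℝ F] {p : ℕ} {W : Fin p → E → F}
    {T : Set E} (hT : IsOpen T) (hW : ∀ j, ContDiffOn ℝ ∞ (W j) T) {y₀ : E} (hy₀ : y₀ ∈ T)
    (hli : LinearIndependent ℝ fun j => W j y₀) :
    ∃ (h : Fin p → Fin p → E → ℝ) (U : Set E) (π : F →L[ℝ] Fin p → ℝ), IsOpen U ∧ y₀ ∈ U ∧ U ⊆ T ∧
      (∀ j l, ContDiffOn ℝ ∞ (h j l) U) ∧
      ∀ y ∈ U, ∀ l, π (∑ j, h j l y • W j y) = Pi.single l 1 := by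
  obtain ⟨π', hπ'⟩ := (Fintype.linearCombination ℝ fun j => W j y₀).exists_leftInverse_of_injective
    (LinearMap.ker_eq_bot.2 hli.fintypeLinearCombination_injective)
  set π : F →L[ℝ] Fin p → ℝ := π'.toContinuousLinearMap with hπ
  let B : E → (Fin p → ℝ) →L[ℝ] F := fun y =>
    ∑ j, (ContinuousLinearMap.proj (R := ℝ) (φ := fun _ : Fin p => ℝ) j).smulRight (W j y)
  have hB : ∀ y c, B y c = ∑ j, c j • W j y := fun y c => by simp [B]
  -- `G` is the identity at `y₀`, hence invertible nearby; the columns of its inverse are the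
  -- required coefficients, smooth because inversion is.
  let G : E → (Fin p → ℝ) →L[ℝ] (Fin p → ℝ) := fun y => π.comp (B y)
  have hG : ContDiffOn ℝ ∞ G T := by
    refine contDiffOn_clm_apply.2 fun c => ?_
    simp only [G, ContinuousLinearMap.comp_apply, hB]
    exact π.contDiff.comp_contDiffOn (ContDiffOn.sum fun j _ => contDiffOn_const.smul (hW j))
  have hG₀ : G y₀ = 1 := by
    ext1 c
    have := DFunLike.congr_fun hπ' c
    simpa [G, hB, hπ, Fintype.linearCombination_apply] using this
  have hU : IsOpen (T ∩ G ⁻¹' {a | IsUnit a}) := hG.continuousOn.isOpen_inter_preimage hT Units.isOpen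
  refine ⟨fun j l y => Ring.inverse (G y) (Pi.single l 1) j, _, π, hU, ⟨hy₀, ?_⟩,
    Set.inter_subset_left, fun j l y hy => ?_, fun y hy l => ?_⟩
  · simp [hG₀]
  · obtain ⟨u, hu⟩ := hy.2
    have h1 : ContDiffAt ℝ ∞ (fun z => Ring.inverse (G z)) y :=
      ContDiffAt.comp (g := Ring.inverse) y (hu ▸ contDiffAt_ringInverse ℝ u)
        (hG.contDiffAt (hT.mem_nhds hy.1))
    exact (contDiffAt_pi.1 (h1.clm_apply contDiffAt_const) j).contDiffWithinAt
  · rw [← hB]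
    exact DFunLike.congr_fun (Ring.mul_inverse_cancel _ hy.2) (Pi.single l 1)

/-- A function whose first `d` partial derivatives vanish on a convex set does not depend on the
first `d` coordinates there. -/
theorem eq_of_fderiv_single_eq_zero {n d : ℕ} {F : Type*} [NormedAddCommGroup F] [NormedSpace ℝ F]
    {f : Model n → F} {s : Set (Model n)} (hs : Convex ℝ s)
    (hf : ∀ y ∈ s, DifferentiableAt ℝ f y)
    (hf' : ∀ y ∈ s, ∀ k : Fin n, k.val < d → fderiv ℝ f y (EuclideanSpace.single k 1) = 0)
    {x y : Model n} (hx : x ∈ s) (hy : y ∈ s) (hxy : ∀ k : Fin n, d ≤ k.val → x k = y k) :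
    f x = f y := by
  have hdir : ∀ z ∈ s, fderiv ℝ f z (y - x) = 0 := by
    intro z hz
    have hsum : y - x = ∑ k, (y - x) k • EuclideanSpace.single k (1 : ℝ) := by
      ext i
      simp [Pi.single_apply]
    rw [hsum, map_sum]
    refine Finset.sum_eq_zero fun k _ => ?_
    rcases lt_or_ge k.val d with hk | hk
    · rw [map_smul, hf' z hz k hk, smul_zero]
    · simp [hxy k hk]
  have hmem : ∀ t ∈ Set.Icc (0 : ℝ) 1, AffineMap.lineMap x y t ∈ s := fun t ht =>
    hs.lineMap_mem hx hy ht
  have hder : ∀ t ∈ Set.Icc (0 : ℝ) 1,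
      HasDerivAt (fun t => f (AffineMap.lineMap x y t)) 0 t := by
    intro t ht
    have h := (hf _ (hmem t ht)).hasFDerivAt.comp_hasDerivAt t
      (AffineMap.hasDerivAt_lineMap (a := x) (b := y))
    rwa [hdir _ (hmem t ht)] at h
  have h := constant_of_has_deriv_right_zero
    (fun t ht => (hder t ht).continuousAt.continuousWithinAt)
    (fun t ht => (hder t (Set.Ico_subset_Icc_self ht)).hasDerivWithinAt) 1 (by simp)
  simpa using h.symm

section Extension

variable {n : ℕ} {M : Type*} [TopologicalSpace M] [T2Space M] [ChartedSpace (Model n) M]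
  [IsManifold (𝓡 n) ∞ M]

/-- Germs of smooth functions extend to the manifold. -/
theorem exists_contMDiff_eventuallyEq {f : M → ℝ} {U : Set M} (hU : IsOpen U) {x₀ : M}
    (hx₀ : x₀ ∈ U) (hf : ContMDiffOn (𝓡 n) 𝓘(ℝ, ℝ) ∞ f U) :
    ∃ g : M → ℝ, ContMDiff (𝓡 n) 𝓘(ℝ, ℝ) ∞ g ∧ g =ᶠ[𝓝 x₀] f := by
  -- The bump function has closed support inside `U`, so its product with `f` is smooth everywhere,
  -- and it equals 1 near `x₀`.
  obtain ⟨χ, hχ, -⟩ := (SmoothBumpFunction.nhds_basis_support (I := 𝓡 n)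
    (hU.mem_nhds hx₀)).mem_iff.1 (hU.mem_nhds hx₀)
  refine ⟨fun x => χ x • f x, contMDiff_of_tsupport fun x hx => ?_, ?_⟩
  · exact χ.contMDiffAt.smul
      (hf.contMDiffAt (hU.mem_nhds (hχ (tsupport_smul_subset_left _ _ hx))))
  · filter_upwards [χ.eventuallyEq_one] with x hx
    simp [hx]

end Extension

theorem exists_linearIndependent_mem {V : Type*} [AddCommGroup V] [Module ℝ V]
    [FiniteDimensional ℝ V] {F : Submodule ℝ V} {p : ℕ} (hp : Module.finrank ℝ F = p) :
    ∃ b : Fin p → V, LinearIndependent ℝ b ∧ ∀ j, b j ∈ F := by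
  subst hp
  exact ⟨fun j => Module.finBasis ℝ F j,
    (Module.finBasis ℝ F).linearIndependent.map' F.subtype F.ker_subtype, fun _ => Subtype.prop _⟩

theorem span_range_eq_of_linearIndependent {V : Type*} [AddCommGroup V] [Module ℝ V]
    [FiniteDimensional ℝ V] {F : Submodule ℝ V} {p : ℕ} {b : Fin p → V}
    (hb : LinearIndependent ℝ b) (hF : ∀ j, b j ∈ F) (hp : Module.finrank ℝ F = p) :
    Submodule.span ℝ (Set.range b) = F := by
  refine Submodule.eq_of_le_of_finrank_eq (Submodule.span_le.2 ?_) ?_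
  · rintro _ ⟨j, rfl⟩
    exact hF j
  · rw [finrank_span_eq_card hb, hp, Fintype.card_fin]

/-! ### A basis independent of the first `d` coordinates -/

section Basis

variable {n : ℕ} {M : Type*} [TopologicalSpace M] [ChartedSpace (Model n) M]
  {φ : OpenPartialHomeomorph M (Model n)}

/-- The coordinates of a covector at `x` in the chart `φ`. -/
def covectorCoord (φ : OpenPartialHomeomorph M (Model n)) (x : M) :
    (TangentSpace (𝓡 n) x →L[ℝ] Bundle.Trivial M ℝ x) →ₗ[ℝ] (Model n →L[ℝ] ℝ) where
  toFun a := ContinuousLinearMap.comp (σ₁₂ := RingHom.id ℝ) (σ₂₃ := RingHom.id ℝ)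
    (M₁ := Model n) (M₃ := ℝ) a
    (mfderiv 𝓘(ℝ, Model n) (𝓡 n) φ.symm (φ x))
  map_add' _ _ := rfl
  map_smul' _ _ := rfl

theorem coordForm_apply_eq_covectorCoord (hφ : φ ∈ IsManifold.maximalAtlas (𝓡 n) ∞ M) {x : M}
    (hx : x ∈ φ.source) (w : ∀ x : M, TangentSpace (𝓡 n) x →L[ℝ] ℝ) :
    coordForm φ w (φ x) = covectorCoord φ x (w x) := by
  ext u
  have h := coordForm_apply_mfderiv hφ hx w (mfderiv 𝓘(ℝ, Model n) (𝓡 n) φ.symm (φ x) u)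
  rw [mfderiv_mfderiv_symm hφ hx] at h
  exact h

theorem covectorCoord_injective (hφ : φ ∈ IsManifold.maximalAtlas (𝓡 n) ∞ M) {x : M}
    (hx : x ∈ φ.source) : Function.Injective (covectorCoord φ x) := by
  intro a b hab
  ext u
  have h := DFunLike.congr_fun hab (mfderiv (𝓡 n) 𝓘(ℝ, Model n) φ x u)
  have ha : ∀ a : TangentSpace (𝓡 n) x →L[ℝ] Bundle.Trivial M ℝ x,
      covectorCoord φ x a (mfderiv (𝓡 n) 𝓘(ℝ, Model n) φ x u) = a u := fun a =>
    congrArg a (mfderiv_symm_mfderiv hφ hx u)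
  exact (ha a).symm.trans (h.trans (ha b))

variable [IsManifold (𝓡 n) ∞ M]

/-- The covector is `∂_k ⌋ dw`, which lies in `Q` by the Cauchy-characteristic property. Its
coordinates are `∂_k w_i - ∂_i w_k`, and `w_k` vanishes on the whole chart domain. -/
theorem exists_covectorCoord_eq_fderiv (hφ : φ ∈ IsManifold.maximalAtlas (𝓡 n) ∞ M)
    {D : Distribution n M} {Q : Codistribution n M} (hc : Contracts D Q) (hQ : Q.Invariant D)
    {d : ℕ} (hs : Straightens φ D d) {w : OneForm n M} (hw : w ∈ Q.sections) {x : M}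
    (hx : x ∈ φ.source) {k : Fin n} (hk : k.val < d) :
    ∃ a ∈ Q.fiber x,
      fderiv ℝ (coordForm φ w) (φ x) (EuclideanSpace.single k 1) = covectorCoord φ x a := by
  have hD : ∀ z ∈ φ.source, coordVec φ k z ∈ D.fiber z := fun z hz => by
    rw [hs z hz]
    exact Submodule.subset_span ⟨k, hk, rfl⟩
  have hzero : ∀ y ∈ φ.target, coordForm φ w y (EuclideanSpace.single k 1) = 0 := by
    intro y hy
    obtain ⟨v, hv, hvy⟩ := D.smooth' _ _ (hD _ (φ.map_target hy))
    have h := hc v hv w hw (φ.symm y)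
    rw [hvy] at h
    rw [← φ.right_inv hy, coordForm_apply_eq_covectorCoord hφ (φ.map_target hy)]
    exact h
  have hflip : ∀ u : Model n, fderiv ℝ (coordForm φ w) (φ x) u (EuclideanSpace.single k 1) = 0 := by
    intro u
    have hev : (fun y => coordForm φ w y (EuclideanSpace.single k 1)) =ᶠ[𝓝 (φ x)]
        fun _ => (0 : ℝ) := by
      filter_upwards [φ.open_target.mem_nhds (φ.map_source hx)] with y hy using hzero y hy
    have h := hev.fderiv_eq (𝕜 := ℝ)
    rw [fderiv_clm_apply ((contDiffAt_coordForm hφ w (φ.map_source hx)).differentiableAt (by simp))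
      (differentiableAt_const _)] at h
    simpa using DFunLike.congr_fun h u
  -- The field `∂_k` is only local; since the contraction depends only on the value at `x`, any
  -- global section of `D` with that value serves.
  obtain ⟨v, hv, hvx⟩ := D.smooth' _ _ (hD x hx)
  refine ⟨_, (sections_subset_cauchyCharacteristic hc hQ hv).2 w hw x, ?_⟩
  ext u
  have h := contractExtDeriv_apply hφ hx w (v x) (mfderiv 𝓘(ℝ, Model n) (𝓡 n) φ.symm (φ x) u)
  rw [mfderiv_mfderiv_symm hφ hx, hvx] at h
  have hk' : (mfderiv (𝓡 n) 𝓘(ℝ, Model n) φ x (coordVec φ k x) : Model n) =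
      EuclideanSpace.single k 1 := mfderiv_mfderiv_symm hφ hx _
  rw [hk', hflip, sub_zero] at h
  rw [hvx]
  exact h.symm

/-- The combination of 1-forms with smooth functions as coefficients. -/
def linearCombination {p : ℕ} (g : Fin p → M → ℝ)
    (hg : ∀ j, ContMDiff (𝓡 n) 𝓘(ℝ, ℝ) ∞ (g j)) (w : Fin p → OneForm n M) : OneForm n M :=
  ⟨fun x => ∑ j, g j x • w j x, ContMDiff.sum_section fun j _ =>
    (hg j).smul_section (w j).contMDiff⟩

/-- Once the frame is normalized by `π`, its derivative along `∂_k` lies both in the span of the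
frame, by invariance, and in the kernel of `π`; these meet only in zero. -/
theorem hasBasisIndepOfFirst [T2Space M] (hφ : φ ∈ IsManifold.maximalAtlas (𝓡 n) ∞ M)
    {D : Distribution n M} {Q : Codistribution n M} (hc : Contracts D Q) (hQ : Q.Invariant D)
    (hdim : Q.LocConstDim) {d : ℕ} (hs : Straightens φ D d) : Q.HasBasisIndepOfFirst φ d := by
  intro x₀ hx₀
  have hrank : ∀ x ∈ φ.source, Module.finrank ℝ ((Q.fiber x).map (covectorCoord φ x)) =
      Module.finrank ℝ (Q.fiber x) := fun x hx =>
    (Submodule.equivMapOfInjective _ (covectorCoord_injective hφ hx) _).symm.finrank_eq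
  obtain ⟨b, hb, hbF⟩ := exists_linearIndependent_mem (hrank x₀ hx₀)
  choose a ha hab using hbF
  choose w hw hwa using fun j => Q.smooth' x₀ (a j) (ha j)
  have hli₀ : LinearIndependent ℝ fun j => coordForm φ (w j) (φ x₀) := by
    have h1 : (fun j => coordForm φ (w j) (φ x₀)) = b := funext fun j => by
      rw [coordForm_apply_eq_covectorCoord hφ hx₀, hwa, hab]
    rw [h1]
    exact hb
  obtain ⟨h, U, π, hU, hx₀U, hUT, hh, hπ⟩ := exists_normalized_frame φ.open_target
    (fun j => contDiffOn_coordForm hφ (w j)) (φ.map_source hx₀) hli₀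
  have hV₀ : IsOpen (φ.source ∩ φ ⁻¹' U) := φ.isOpen_inter_preimage hU
  -- The normalizing coefficients are local, while members of `OneForm` are global; only the germs
  -- at `x₀` matter.
  choose g hg hgh using fun j l => exists_contMDiff_eventuallyEq hV₀ ⟨hx₀, hx₀U⟩
    (((hh j l).contMDiffOn).comp ((contMDiffOn_of_mem_maximalAtlas hφ).mono Set.inter_subset_left)
      (fun x hx => hx.2) : ContMDiffOn (𝓡 n) 𝓘(ℝ, ℝ) ∞ (h j l ∘ φ) (φ.source ∩ φ ⁻¹' U))
  let α : Fin _ → OneForm n M := fun l => linearCombination (fun j => g j l) (fun j => hg j l) w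
  have hα : ∀ l, α l ∈ Q.sections := fun l x =>
    (Q.fiber x).sum_mem (t := Finset.univ) (f := fun j => g j l x • w j x)
      fun j _ => (Q.fiber x).smul_mem (g j l x) (hw j x)
  have hnear : ∀ᶠ x in 𝓝 x₀, x ∈ φ.source ∩ φ ⁻¹' U ∧ (∀ j l, g j l x = h j l (φ x)) ∧
      Module.finrank ℝ (Q.fiber x) = Module.finrank ℝ (Q.fiber x₀) :=
    (hV₀.eventually_mem ⟨hx₀, hx₀U⟩).and ((Filter.eventually_all.2 fun j =>
      Filter.eventually_all.2 fun l => hgh j l).and (hdim.eventually_eq x₀))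
  have hsymm : Filter.Tendsto φ.symm (𝓝 (φ x₀)) (𝓝 x₀) := by
    simpa only [ContinuousAt, φ.left_inv hx₀] using φ.continuousAt_symm (φ.map_source hx₀)
  -- A ball in coordinates is convex, so vanishing partial derivatives there give independence of
  -- the first `d` coordinates.
  obtain ⟨r, hr, hball⟩ := Metric.eventually_nhds_iff_ball.1
    ((hsymm.eventually hnear).and (φ.open_target.eventually_mem (φ.map_source hx₀)))
  have hball' : ∀ x ∈ φ.source ∩ φ ⁻¹' Metric.ball (φ x₀) r,
      (∀ j l, g j l x = h j l (φ x)) ∧ Module.finrank ℝ (Q.fiber x) = Module.finrank ℝ (Q.fiber x₀) ∧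
        φ x ∈ U := by
    intro x hx
    have h1 := (hball _ hx.2).1
    rw [φ.left_inv hx.1] at h1
    exact ⟨h1.2.1, h1.2.2, h1.1.2⟩
  have hcoord : ∀ x ∈ φ.source, ∀ l,
      coordForm φ (α l) (φ x) = ∑ j, g j l x • coordForm φ (w j) (φ x) := by
    intro x hx l
    simp only [coordForm_apply_eq_covectorCoord hφ hx]
    refine (map_sum (covectorCoord φ x) _ _).trans (Finset.sum_congr rfl fun j _ => ?_)
    exact map_smul (covectorCoord φ x) _ _
  have hπα : ∀ x ∈ φ.source ∩ φ ⁻¹' Metric.ball (φ x₀) r, ∀ l,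
      π (coordForm φ (α l) (φ x)) = Pi.single l 1 := by
    intro x hx l
    obtain ⟨h1, -, h3⟩ := hball' x hx
    rw [hcoord x hx.1, ← hπ (φ x) h3 l]
    simp only [h1]
  have hbasis : ∀ x ∈ φ.source ∩ φ ⁻¹' Metric.ball (φ x₀) r,
      LinearIndependent ℝ (fun l => α l x) ∧
        Submodule.span ℝ (Set.range fun l => α l x) = Q.fiber x := by
    intro x hx
    have hli : LinearIndependent ℝ (fun l => α l x) := by
      refine LinearIndependent.of_comp (π.toLinearMap ∘ₗ covectorCoord φ x) ?_
      have h1 : (π.toLinearMap ∘ₗ covectorCoord φ x) ∘ (fun l => α l x) =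
          fun l => Pi.single l 1 := by
        funext l
        rw [← hπα x hx l, coordForm_apply_eq_covectorCoord hφ hx.1]
        rfl
      rw [h1]
      exact Pi.linearIndependent_single_one _ ℝ
    have hli' := hli.map' _ (LinearMap.ker_eq_bot.2 (covectorCoord_injective hφ hx.1))
    refine ⟨hli, Submodule.map_injective_of_injective (covectorCoord_injective hφ hx.1)
      ?_⟩
    rw [Submodule.map_span, ← Set.range_comp]
    -- Local constancy of the dimension enters here: the independent forms are as many as the
    -- dimension of `Q` at `x₀`, hence at `x`.
    exact span_range_eq_of_linearIndependent hli' (fun l => ⟨_, hα l x, rfl⟩)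
      ((hrank x hx.1).trans (hball' x hx).2.1)

  have hderiv : ∀ l, ∀ y ∈ Metric.ball (φ x₀) r, ∀ k : Fin n, k.val < d →
      fderiv ℝ (coordForm φ (α l)) y (EuclideanSpace.single k 1) = 0 := by
    intro l y hy k hk
    have hyt := (hball y hy).2
    have hx : φ.symm y ∈ φ.source ∩ φ ⁻¹' Metric.ball (φ x₀) r :=
      ⟨φ.map_target hyt, by rwa [Set.mem_preimage, φ.right_inv hyt]⟩
    obtain ⟨a, ha, hfa⟩ := exists_covectorCoord_eq_fderiv hφ hc hQ hs (hα l) hx.1 hk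
    rw [← (hbasis _ hx).2, Submodule.mem_span_range_iff_exists_fun] at ha
    obtain ⟨c, rfl⟩ := ha
    rw [map_sum, φ.right_inv hyt] at hfa
    have hπ0 : π (fderiv ℝ (coordForm φ (α l)) y (EuclideanSpace.single k 1)) = 0 := by
      have hev : (fun z => π (coordForm φ (α l) z)) =ᶠ[𝓝 y] fun _ => Pi.single l 1 := by
        filter_upwards [Metric.isOpen_ball.mem_nhds hy] with z hz
        have hzt := (hball z hz).2
        have h1 := hπα (φ.symm z) ⟨φ.map_target hzt, by rwa [Set.mem_preimage, φ.right_inv hzt]⟩ l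
        rwa [φ.right_inv hzt] at h1
      have h1 := hev.fderiv_eq (𝕜 := ℝ)
      have h2 := (π.hasFDerivAt.comp y
        ((contDiffAt_coordForm hφ (α l) hyt).differentiableAt (by simp)).hasFDerivAt).fderiv
      have h3 := DFunLike.congr_fun (h2.symm.trans h1) (EuclideanSpace.single k 1)
      simpa using h3
    -- Applying `π` to the combination of frame elements returns the coefficient vector `c` itself.
    have hc0 : c = 0 := by
      rw [hfa, map_sum] at hπ0
      rw [← hπ0]
      have h1 : ∀ i, π (covectorCoord φ (φ.symm y) (c i • α i (φ.symm y))) =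
          c i • Pi.single i 1 := by
        intro i
        rw [map_smul, map_smul, ← hπα _ hx i, coordForm_apply_eq_covectorCoord hφ hx.1]
      simp only [h1]
      exact pi_eq_sum_univ' c
    rw [hfa, hc0]
    simp
  refine ⟨φ.source ∩ φ ⁻¹' Metric.ball (φ x₀) r, φ.isOpen_inter_preimage Metric.isOpen_ball,
    ⟨hx₀, Metric.mem_ball_self hr⟩, Set.inter_subset_left, _, α, hbasis, ?_⟩
  intro l x hx y hy hxy i
  have h1 := eq_of_fderiv_single_eq_zero (f := coordForm φ (α l)) (convex_ball (φ x₀) r)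
    (fun z hz => (contDiffAt_coordForm hφ (α l) (hball z hz).2).differentiableAt (by simp))
    (hderiv l) hx.2 hy.2 hxy
  rw [coordForm_apply_eq_covectorCoord hφ hx.1, coordForm_apply_eq_covectorCoord hφ hy.1] at h1
  exact DFunLike.congr_fun h1 (EuclideanSpace.single i 1)

end Basis
end Codist

end

theorem mainTheorem6 (n : ℕ) (M : Type*) [TopologicalSpace M] [T2Space M]
    [ChartedSpace (Codist.Model n) M] [IsManifold (𝓡 n) ∞ M]
    (P : Codist.Codistribution n M) (hP : P.LocConstDim)
    (D : Codist.Distribution n M) (hD : D.LocConstDim) (hinv : D.Involutive)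
    (hDP : Codist.Contracts D P) :
    ∃ Phat : Codist.Codistribution n M,
      (IsLeast {Q | P ≤ Q ∧ Q.Invariant D} Phat ∧
        ∀ Q, IsLeast {Q | P ≤ Q ∧ Q.Invariant D} Q → Q = Phat) ∧
      Codist.Contracts D Phat ∧
      D.sections ⊆ Phat.cauchyCharacteristic ∧
      (Phat.LocConstDim →
        IsLeast {Q | Q.LocConstDim ∧ P ≤ Q ∧ Q.Invariant D} Phat ∧
        ∀ φ ∈ IsManifold.maximalAtlas (𝓡 n) ∞ M, ∀ d : ℕ,
          Codist.Straightens φ D d → Phat.HasBasisIndepOfFirst φ d) := by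
  have hleast := Codist.isLeast_invariantHull P D
  have hcon := Codist.contracts_invariantHull hinv hDP
  exact ⟨Codist.invariantHull P D, ⟨hleast, fun Q hQ => hQ.unique hleast⟩, hcon,
    Codist.sections_subset_cauchyCharacteristic hcon hleast.1.2, fun hdim =>
      ⟨⟨⟨hdim, hleast.1⟩, fun _ hQ => hleast.2 hQ.2⟩, fun _ hφ _ hs =>
        Codist.hasBasisIndepOfFirst hφ hcon hleast.1.2 hdim hs⟩⟩
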